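/- Fix $n\ge 3$. The $n$-cycle scenario has $n$ two-outcome measurements $X_i$ ($i\in\mathbb Z/n$) and the contexts $\{X_i,X_{i+1}\}$. A behavior assigns to each context $\gamma$ a probability distribution $p_\gamma$ on the joint outcomes of the measurements in $\gamma$; it is non-disturbing if any two contexts induce the same marginal on their intersection, and non-contextual if the $p_\gamma$ are the marginals of one joint distribution of the outcomes of all measurements. A non-contextual wiring acts on a behavior $\{p_\gamma\}$ by $$p'_\beta(\mathbf t)=\sum_{\mathbf r}p_\beta(\mathbf r)\sum_{\mathbf s}p_{\gamma(\mathbf r)}(\mathbf s)\sum_\phi p(\phi)\prod_{x\in\beta}p(t_x\mid x,r_x,s_x,\phi).$$ Here $p_\beta(\mathbf r)$ is a non-contextual behavior on the same measurements and contexts, with outcomes in some finite set; each outcome $r_x$ selects a measurement of the $n$-cycle, in such a way that for every $\mathbf r$ with $p_\beta(\mathbf r)>0$ the selected measurements form a context $\gamma(\mathbf r)$; $s_x$ is the outcome of the measurement selected by $r_x$; $\phi$ is a random variable with finitely many values; and each $p(\cdot\mid x,r_x,s_x,\phi)$ is a probability distribution on the two outcomes. For non-disturbing behaviors $B,B'$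 of the $n$-cycle scenario write $B\to B'$ if some non-contextual wiring turns $B$ into $B'$. Call $B,B'$ equivalent if $B\to B'$ and $B'\to B$, strictly ordered if exactly one of these holds, and incomparable if neither holds. Theorem. The relation $\to$ is a pre-order on the set of non-disturbing behaviors of the $n$-cycle scenario, and: 1. it is locally infinite: there are inequivalent $B_1,B_3$ such that the behaviors $B_2$ with $B_1\to B_2$ and $B_2\to B_3$ form infinitely many equivalence classes; 2. it is not totally pre-ordered: there are incomparable behaviors; 3. it is not weak: there are $B_1,B_2,B_3$ such that $B_1$ and $B_2$ are incomparable, $B_2$ and $B_3$ are incomparable, and $B_1$ and $B_3$ are strictly ordered; 4. its height is infinite: there is an infinite set of behaviors any two distinct elements of which are strictly ordered; 5. its width is infinite: there is an infinite set of pairwise incomparable behaviors. -/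

import Mathlib

open Finset

namespace Contextuality

/-- A compatibility scenario with finite set of measurements `M` and finite set of outcomes `O`:
the family of contexts, i.e. the sets of measurements that can be performed jointly. -/
structure CompatScenario (M O : Type) where
  contexts : Set (Finset M)

section

variable {M O M' O' : Type} [DecidableEq M] [Fintype M] [DecidableEq O] [Fintype O]
  [DecidableEq M'] [Fintype M'] [DecidableEq O'] [Fintype O']

/-- A behavior: for every context `γ` a probability distribution `prob γ` on `O^γ`.
(For a set `γ` that is not a context, `prob γ` carries no information and is set to `0`.) -/
structure Behavior (S : CompatScenario M O) where
  prob : (γ : Finset M) → (γ → O) → ℝ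
  nonneg : ∀ γ ∈ S.contexts, ∀ s, 0 ≤ prob γ s
  sum_eq_one : ∀ γ ∈ S.contexts, ∑ s, prob γ s = 1
  eq_zero_of_notMem : ∀ γ, γ ∉ S.contexts → ∀ s, prob γ s = 0

/-- The marginal on `δ ⊆ γ` of a distribution on `O^γ`. -/
def marginal {γ δ : Finset M} (h : δ ⊆ γ) (p : (γ → O) → ℝ) (u : δ → O) : ℝ :=
  ∑ s : γ → O with Finset.restrict₂ (π := fun _ => O) h s = u, p s

/-- The non-disturbance condition: any two contexts induce the same marginal on their
intersection. -/
def Behavior.IsNonDisturbing {S : CompatScenario M O} (B : Behavior S) : Prop :=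
  ∀ γ ∈ S.contexts, ∀ γ' ∈ S.contexts, ∀ u : ↥(γ ∩ γ') → O,
    marginal Finset.inter_subset_left (B.prob γ) u =
      marginal Finset.inter_subset_right (B.prob γ') u

/-- A behavior is non-contextual if it has a global section: a probability distribution on `O^M`
whose marginals on the contexts are the distributions of the behavior. -/
def Behavior.IsNonContextual {S : CompatScenario M O} (B : Behavior S) : Prop :=
  ∃ g : (M → O) → ℝ, (∀ f, 0 ≤ g f) ∧ ∑ f, g f = 1 ∧
    ∀ γ ∈ S.contexts, ∀ s : γ → O,
      B.prob γ s = ∑ f : M → O with Finset.restrict (π := fun _ => O) γ f = s, g f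

/-- The set of measurements `{f x : x ∈ β}` selected by `f : β → M`. -/
def target {β : Finset M'} (f : β → M) : Finset M := univ.image f

/-- The measurement `f x`, as an element of `target f`. -/
def toTarget {β : Finset M'} (f : β → M) (x : β) : target f :=
  ⟨f x, Finset.mem_image_of_mem f (Finset.mem_univ x)⟩

/-- A non-contextual wiring, turning behaviors of `S` (measurements `M`, outcomes `O`) into
behaviors of `S'` (measurements `M'`, outcomes `O'`).

* Pre-processing: a non-contextual behavior `pre` with the measurements and contexts of `S'` and
  outcomes in a finite set `PreOut`. The outcome `r x` of the measurement `x` selects the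
  measurement `toMeas (r x)` of `S`; whenever `r` is a possible joint outcome on a context `β`,
  the selected measurements form a context of `S`.
* Post-processing: a kernel of the form `∑ φ, p(φ) ∏ x, p(t x | x, r x, s x, φ)`, where `φ` is a
  shared random variable with values in a finite set `Shared`, `x` runs over the measurements in
  the context, `r x` is the outcome of the pre-processing at `x`, `s x` is the outcome of the
  measurement of `S` that was selected by `r x`, and `t x` is the final outcome at `x`. -/
structure Wiring (S : CompatScenario M O) (S' : CompatScenario M' O') where
  PreOut : Type
  [fintypePreOut : Fintype PreOut]
  [decEqPreOut : DecidableEq PreOut]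
  pre : Behavior (CompatScenario.mk S'.contexts : CompatScenario M' PreOut)
  pre_nonContextual : pre.IsNonContextual
  toMeas : PreOut → M
  target_mem : ∀ β ∈ S'.contexts, ∀ r : β → PreOut, 0 < pre.prob β r →
    target (fun x => toMeas (r x)) ∈ S.contexts
  Shared : Type
  [fintypeShared : Fintype Shared]
  weight : Shared → ℝ
  weight_nonneg : ∀ φ, 0 ≤ weight φ
  weight_sum : ∑ φ, weight φ = 1
  post : Shared → M' → PreOut → O → O' → ℝ
  post_nonneg : ∀ φ x r s t, 0 ≤ post φ x r s t
  post_sum : ∀ φ x r s, ∑ t, post φ x r s t = 1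

attribute [instance] Wiring.fintypePreOut Wiring.decEqPreOut Wiring.fintypeShared

/-- The distribution on `O'^β` that the wiring `W` produces from the behavior `B`:
`p_β(t) = ∑_r p_β(r) ∑_s p_{γ(r)}(s) ∑_φ p(φ) ∏_x p(t_x | x, r_x, s_x, φ)`. -/
noncomputable def Wiring.output {S : CompatScenario M O} {S' : CompatScenario M' O'}
    (W : Wiring S S') (B : Behavior S) (β : Finset M') (t : β → O') : ℝ :=
  ∑ r : β → W.PreOut, W.pre.prob β r *
    ∑ s : target (fun x => W.toMeas (r x)) → O, B.prob (target fun x => W.toMeas (r x)) s *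
      ∑ φ, W.weight φ *
        ∏ x : β, W.post φ x (r x) (s (toTarget (fun x => W.toMeas (r x)) x)) (t x)

/-- `B → B'`: some non-contextual wiring turns `B` into `B'`. -/
def Behavior.Converts {S : CompatScenario M O} {S' : CompatScenario M' O'}
    (B : Behavior S) (B' : Behavior S') : Prop :=
  ∃ W : Wiring S S', ∀ β ∈ S'.contexts, ∀ t : β → O', B'.prob β t = W.output B β t

/-- The set `ND(S)` of non-disturbing behaviors of a scenario. -/
def ND (S : CompatScenario M O) : Type := {B : Behavior S // B.IsNonDisturbing}

/-- Convertibility by non-contextual wirings, on the non-disturbing behaviors of a scenario. -/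
def ND.conv {S : CompatScenario M O} (B B' : ND S) : Prop := B.1.Converts B'.1

end

/-- The `n`-cycle scenario: measurements `X_i`, `i ∈ ℤ/n`, with two outcomes each, and the contexts
`{X_i, X_{i+1}}`. -/
def nCycle (n : ℕ) : CompatScenario (ZMod n) Bool where
  contexts := Set.range fun i : ZMod n => ({i, i + 1} : Finset (ZMod n))

/-! Global properties of a pre-order `r`, where `r a b` is read "`a` can be converted into `b`". -/

section

variable {α : Type*} (r : α → α → Prop)

/-- `a` is strictly above `b`. -/
def StrictlyAbove (a b : α) : Prop := r a b ∧ ¬ r b a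

/-- `a` and `b` are equivalent. -/
def Equivalent (a b : α) : Prop := r a b ∧ r b a

/-- `a` and `b` are incomparable. -/
def Incomparable (a b : α) : Prop := ¬ r a b ∧ ¬ r b a

/-- Every pair of objects is strictly ordered or equivalent. -/
def TotallyPreordered : Prop :=
  ∀ a b, StrictlyAbove r a b ∨ StrictlyAbove r b a ∨ Equivalent r a b

/-- Incomparability is transitive. Equivalent objects are never incomparable, so transitivity is
understood up to equivalence, as usual for weak orders (without this proviso, `a ∥ b` and `b ∥ a`
would already refute transitivity). Hence a pre-order fails to be weak iff there are `a ∥ b ∥ c`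
with `a` and `c` strictly ordered. -/
def IsWeakPreorder : Prop :=
  ∀ a b c, Incomparable r a b → Incomparable r b c → Incomparable r a c ∨ Equivalent r a c

/-- A chain: every two distinct elements are strictly ordered. -/
def IsStrictChain (s : Set α) : Prop :=
  s.Pairwise fun a b => StrictlyAbove r a b ∨ StrictlyAbove r b a

/-- An antichain: every two distinct elements are incomparable. -/
def IsIncomparableSet (s : Set α) : Prop := s.Pairwise (Incomparable r)

/-- The cardinality of the largest chain is infinite. -/
def InfiniteHeight : Prop := ∃ s : Set α, IsStrictChain r s ∧ s.Infinite

/-- The cardinality of the largest antichain is infinite. -/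
def InfiniteWidth : Prop := ∃ s : Set α, IsIncomparableSet r s ∧ s.Infinite

/-- The equivalence class of `b`. -/
def equivClass (b : α) : Set α := {c | Equivalent r b c}

/-- The set of the equivalence classes of the objects `b` with `a → b` and `b → c`. -/
def intervalClasses (a c : α) : Set (Set α) := equivClass r '' {b | r a b ∧ r b c}

/-- Between any two inequivalent objects there are only finitely many equivalence classes. -/
def LocallyFinitePreorder : Prop := ∀ a c, ¬ Equivalent r a c → (intervalClasses r a c).Finite

/-- Not locally finite. -/
def LocallyInfinite : Prop := ¬ LocallyFinitePreorder r

end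

end Contextuality

/-! A non-contextual wiring is the same thing as a finite mixture of deterministic relabelings
(`Behavior.Converts.isMixture`, `Behavior.IsMixture.converts`): all its randomness can be drawn in
advance. Mixtures compose, so convertibility is a pre-order.

The witnesses are mixtures, with weights `x`, `y`, `t`, of the constant assignments `false` and
`true` and a Popescu–Rohrlich box, with `0 < y ≤ x`. They are perfectly correlated on every context
but `{0, 1}`. In a conversion between two of them, an event of probability zero in the result has
probability zero in every component that occurs. Since both constants have positive weight, each
component therefore applies the same outcome map at neighbouring measurements, hence, along the path
from `1` round to `0`, at all of them. Anticorrelation on `{0, 1}` survives only if this map is a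
permutation, and then the outcome (true, true) has probability at least `y`. Summing over components
gives `t' = q * t` and `q * y ≤ y'` with `0 ≤ q ≤ 1` (`tiltedBehavior_converts_necessary`): `t`
cannot grow and `y / t` cannot fall. Conversely `t` can be lowered at fixed `y / t`
(`tiltedBehavior_converts_of_le`).

In the coordinates `(t, y / t)`, segments of constant ratio are thus strict chains and increasing
curves are antichains; all five claims follow. -/

set_option linter.unusedSectionVars false

/-! ### Wirings as mixtures of deterministic relabelings -/

namespace Contextuality

section

variable {M O M' O' M'' O'' : Type} [DecidableEq M] [Fintype M] [DecidableEq O] [Fintype O]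
  [DecidableEq M'] [Fintype M'] [DecidableEq O'] [Fintype O']
  [DecidableEq M''] [Fintype M''] [DecidableEq O''] [Fintype O'']

/-- The behavior on `β` obtained from `B` by measuring `m x` in place of `x` and mapping its
outcome by `f x`. -/
noncomputable def Behavior.relabel {S : CompatScenario M O} (B : Behavior S) (m : M' → M)
    (f : M' → O → O') (β : Finset M') (t : β → O') : ℝ :=
  ∑ s : target (fun x : β => m x) → O, B.prob (target fun x : β => m x) s *
    if (fun x : β => f x (s (toTarget (fun x : β => m x) x))) = t then 1 else 0

/-- `B'` is a finite mixture of deterministic relabelings of `B`. -/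
def Behavior.IsMixture {S : CompatScenario M O} {S' : CompatScenario M' O'}
    (B : Behavior S) (B' : Behavior S') : Prop :=
  ∃ (ι : Type) (_ : Fintype ι) (w : ι → ℝ) (m : ι → M' → M) (f : ι → M' → O → O'),
    (∀ i, 0 ≤ w i) ∧ ∑ i, w i = 1 ∧
    (∀ i, 0 < w i → ∀ β ∈ S'.contexts, target (fun x : β => m i x) ∈ S.contexts) ∧
    ∀ β ∈ S'.contexts, ∀ t, B'.prob β t = ∑ i, w i * B.relabel (m i) (f i) β t

/-- Contexts built with `target` coincide only up to a proof; comparing assignments pointwise avoids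
casts between them. -/
theorem Behavior.sum_prob_mul_congr {S : CompatScenario M O} (B : Behavior S) {γ γ' : Finset M}
    (h : γ = γ') (F : (γ → O) → ℝ) (F' : (γ' → O) → ℝ)
    (hF : ∀ s s', (∀ z (hz : z ∈ γ) (hz' : z ∈ γ'), s ⟨z, hz⟩ = s' ⟨z, hz'⟩) → F s = F' s') :
    ∑ s, B.prob γ s * F s = ∑ s, B.prob γ' s * F' s := by
  subst h
  exact sum_congr rfl fun s _ => by rw [hF s s fun _ _ _ => rfl]

theorem target_val (β : Finset M) : target (fun x : β => (x : M)) = β := by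
  ext z
  simp [target]

theorem target_comp (m : M' → M) (m₂ : M'' → M') (β : Finset M'') :
    target (fun y : target (fun x : β => m₂ x) => m y) = target fun x : β => m (m₂ x) := by
  ext z
  constructor
  · intro h
    obtain ⟨⟨y, hy⟩, -, rfl⟩ := mem_image.1 h
    obtain ⟨x, -, rfl⟩ := mem_image.1 hy
    exact mem_image.2 ⟨x, mem_univ _, rfl⟩
  · intro h
    obtain ⟨x, -, rfl⟩ := mem_image.1 h
    exact mem_image.2 ⟨⟨m₂ x, mem_image.2 ⟨x, mem_univ _, rfl⟩⟩, mem_univ _, rfl⟩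

theorem Behavior.relabel_id {S : CompatScenario M O} (B : Behavior S) (β : Finset M) (t : β → O) :
    B.relabel id (fun _ => id) β t = B.prob β t := by
  refine (B.sum_prob_mul_congr (target_val β) _ (fun s => if s = t then 1 else 0)
    fun s s' h => ?_).trans (by simp)
  congr 1
  refine congrArg (· = t) (funext fun x => ?_)
  exact h x _ x.2

theorem Behavior.isMixture_refl {S : CompatScenario M O} (B : Behavior S) : B.IsMixture B := by
  refine ⟨Unit, inferInstance, fun _ => 1, fun _ => id, fun _ _ => id, fun _ => zero_le_one,
    by simp, fun _ _ β hβ => ?_, fun β _ t => ?_⟩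
  · simpa [target_val] using hβ
  · simp [B.relabel_id]

/-- Relabelings compose: measurements are selected through `m ∘ m₂`, and the outcome maps are
applied in turn. -/
theorem Behavior.sum_relabel_mul {S : CompatScenario M O} (B : Behavior S) (m : M' → M)
    (f : M' → O → O') (m₂ : M'' → M') (f₂ : M'' → O' → O'') (β : Finset M'') (t : β → O'') :
    (∑ s, B.relabel m f (target fun x : β => m₂ x) s *
      if (fun x : β => f₂ x (s (toTarget (fun x : β => m₂ x) x))) = t then 1 else 0) =
    B.relabel (fun x => m (m₂ x)) (fun x o => f₂ x (f (m₂ x) o)) β t := by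
  unfold Behavior.relabel
  simp_rw [sum_mul]
  rw [sum_comm]
  simp_rw [mul_assoc, ← mul_sum, ite_mul, one_mul, zero_mul, sum_ite_eq, mem_univ, if_true]
  refine B.sum_prob_mul_congr (target_comp m m₂ β) _ _ fun s s' h => ?_
  congr 1
  refine congrArg (· = t) (funext fun x => ?_)
  exact congrArg (fun o => f₂ x (f (m₂ x) o)) (h _ _ _)

theorem Behavior.IsMixture.trans {S : CompatScenario M O} {S' : CompatScenario M' O'}
    {S'' : CompatScenario M'' O''} {B : Behavior S} {B' : Behavior S'} {B'' : Behavior S''}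
    (h : B.IsMixture B') (h' : B'.IsMixture B'') : B.IsMixture B'' := by
  obtain ⟨ι, _, w, m, f, hw, hw1, hm, hB⟩ := h
  obtain ⟨κ, _, w', m', f', hw', hw1', hm', hB'⟩ := h'
  refine ⟨κ × ι, inferInstance, fun k => w' k.1 * w k.2, fun k x => m k.2 (m' k.1 x),
    fun k x o => f' k.1 x (f k.2 (m' k.1 x) o), fun k => mul_nonneg (hw' _) (hw _), ?_, ?_, ?_⟩
  · rw [Fintype.sum_prod_type]
    simp_rw [← mul_sum, hw1, mul_one, hw1']
  · rintro ⟨j, i⟩ hpos β hβ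
    have hj : 0 < w' j := (hw' j).lt_of_ne fun h => by simp [← h] at hpos
    have hi : 0 < w i := (hw i).lt_of_ne fun h => by simp [← h] at hpos
    rw [← target_comp (m i) (m' j)]
    exact hm i hi _ (hm' j hj β hβ)
  · intro β hβ t
    rw [hB' β hβ t, Fintype.sum_prod_type]
    refine sum_congr rfl fun j _ => ?_
    -- A component of weight zero need not send contexts to contexts, so `hB` applies only to the
    -- others.
    rcases (hw' j).eq_or_lt with h0 | hj
    · simp [← h0]
    simp_rw [mul_assoc, ← mul_sum, ← Behavior.sum_relabel_mul]
    congr 1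
    rw [Behavior.relabel]
    simp_rw [hB _ (hm' j hj β hβ), mul_sum, sum_mul]
    rw [sum_comm]
    simp_rw [mul_assoc]

theorem sum_prod_mul_ite_eq {J Y : Type*} [Fintype J] [DecidableEq J] [Fintype Y] [DecidableEq Y]
    (q : J → Y → ℝ) (hq : ∀ j, ∑ y, q j y = 1) (j₀ : J) (y₀ : Y) :
    ∑ ω : J → Y, (∏ j, q j (ω j)) * (if ω j₀ = y₀ then 1 else 0) = q j₀ y₀ := by
  have key : ∀ ω : J → Y, (∏ j, q j (ω j)) * (if ω j₀ = y₀ then 1 else 0) =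
      ∏ j, q j (ω j) * (if j = j₀ then (if ω j = y₀ then 1 else 0) else 1) := by
    intro ω
    rw [prod_mul_distrib, prod_ite_eq' univ j₀]
    simp
  simp_rw [key]
  rw [← Fintype.prod_sum (fun j y => q j y * (if j = j₀ then (if y = y₀ then 1 else 0) else 1)),
    prod_eq_single j₀]
  · simp
  · intro j _ hj
    simp [hj, hq]
  · simp

/-- For independent `ω j` of law `q j`, the expectation of a product factorizes, and coordinates
outside `β` integrate to `1`. -/
theorem sum_prod_mul_prod_subtype {J Y : Type*} [Fintype J] [DecidableEq J] [Fintype Y]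
    (q : J → Y → ℝ) (hq : ∀ j, ∑ y, q j y = 1) (β : Finset J) (c : β → Y → ℝ) :
    ∑ ω : J → Y, (∏ j, q j (ω j)) * (∏ x : β, c x (ω x)) = ∏ x : β, ∑ y, q x y * c x y := by
  have key : ∀ ω : J → Y, (∏ j, q j (ω j)) * (∏ x : β, c x (ω x)) =
      ∏ j, q j (ω j) * (if h : j ∈ β then c ⟨j, h⟩ (ω j) else 1) := by
    intro ω
    rw [prod_mul_distrib]
    congr 1
    rw [← prod_subset (subset_univ β) (fun j _ hj => by simp [hj]), ← prod_coe_sort β]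
    exact prod_congr rfl fun x _ => by simp
  simp_rw [key]
  rw [← Fintype.prod_sum (fun j y => q j y * (if h : j ∈ β then c ⟨j, h⟩ y else 1)),
    ← prod_subset (subset_univ β) (fun j _ hj => by simp [hj, hq]), ← prod_coe_sort β]
  exact prod_congr rfl fun x _ => by simp

theorem prod_ite_eq_ite_funext {J Y : Type*} [Fintype J] [DecidableEq Y] (a b : J → Y) :
    (∏ j, if a j = b j then (1 : ℝ) else 0) = if a = b then 1 else 0 := by
  rw [Fintype.prod_ite_zero]
  simp [funext_iff]

/-- Everything random is sampled beforehand: a global assignment of pre-processing outcomes from the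
global section, the shared variable, and for each measurement a response function `O → O'` whose
values are drawn independently from the kernel. What remains is deterministic. -/
theorem Behavior.Converts.isMixture {S : CompatScenario M O} {S' : CompatScenario M' O'}
    {B : Behavior S} {B' : Behavior S'} (h : B.Converts B') : B.IsMixture B' := by
  obtain ⟨W, hW⟩ := h
  obtain ⟨g, hg, hg1, hgp⟩ := W.pre_nonContextual
  have hq : ∀ φ (h : M' → W.PreOut) (x : M'),
      ∑ ω : O → O', ∏ s, W.post φ x (h x) s (ω s) = 1 := by
    intro φ h x
    rw [← Fintype.prod_sum]
    simp [W.post_sum]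
  refine ⟨(M' → W.PreOut) × W.Shared × (M' → O → O'), inferInstance,
    fun i => g i.1 * (W.weight i.2.1 * ∏ x, ∏ s, W.post i.2.1 x (i.1 x) s (i.2.2 x s)),
    fun i x => W.toMeas (i.1 x), fun i => i.2.2, ?_, ?_, ?_, ?_⟩
  · exact fun i => mul_nonneg (hg _) (mul_nonneg (W.weight_nonneg _)
      (prod_nonneg fun _ _ => prod_nonneg fun _ _ => W.post_nonneg _ _ _ _ _))
  · simp_rw [Fintype.sum_prod_type, ← mul_sum]
    have : ∀ φ (h : M' → W.PreOut),
        ∑ ω : M' → O → O', ∏ x, ∏ s, W.post φ x (h x) s (ω x s) = 1 := by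
      intro φ h
      rw [← Fintype.prod_sum (fun x (ω : O → O') => ∏ s, W.post φ x (h x) s (ω s))]
      simp [hq]
    simp_rw [this, mul_one, W.weight_sum, mul_one, hg1]
  · rintro ⟨h, φ, ω⟩ hpos β hβ
    have hh : 0 < g h := (hg h).lt_of_ne fun h0 => by simp [← h0] at hpos
    refine W.target_mem β hβ (fun x => h x) ?_
    rw [hgp β hβ]
    -- The restriction of `h` to `β` has marginal probability at least `g h`.
    exact hh.trans_le (single_le_sum (fun f _ => hg f) (by simp; rfl))
  · intro β hβ t
    rw [hW β hβ t, Wiring.output]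
    simp_rw [hgp β hβ, sum_filter, sum_mul]
    rw [sum_comm]
    simp_rw [ite_mul, zero_mul, sum_ite_eq, mem_univ, if_true, Fintype.sum_prod_type,
      mul_assoc, ← mul_sum]
    refine sum_congr rfl fun h _ => ?_
    congr 1
    -- Only the value of each response function at the observed outcome matters, so averaging over
    -- the functions returns the kernel.
    have hprod : ∀ φ (s : target (fun x : β => W.toMeas (h x)) → O),
        (∏ x : β, W.post φ x (h x) (s (toTarget (fun x : β => W.toMeas (h x)) x)) (t x)) =
        ∑ ω : M' → O → O', (∏ x, ∏ s, W.post φ x (h x) s (ω x s)) *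
          if (fun x : β => ω x (s (toTarget (fun x : β => W.toMeas (h x)) x))) = t
            then 1 else 0 := by
      intro φ s
      simp_rw [← prod_ite_eq_ite_funext]
      rw [sum_prod_mul_prod_subtype (fun x (ω : O → O') => ∏ s, W.post φ x (h x) s (ω s)) (hq φ h)
        β (fun x ω => if ω (s (toTarget (fun x : β => W.toMeas (h x)) x)) = t x then 1 else 0)]
      refine prod_congr rfl fun x _ => ?_
      rw [sum_prod_mul_ite_eq (fun s => W.post φ x (h x) s) (W.post_sum φ x (h x))]
    change ∑ s : target (fun x : β => W.toMeas (h x)) → O, B.prob _ s * ∑ φ, W.weight φ *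
      (∏ x : β, W.post φ x (h x) (s (toTarget (fun x : β => W.toMeas (h x)) x)) (t x)) = _
    simp_rw [hprod, Behavior.relabel, mul_sum]
    rw [sum_comm]
    refine sum_congr rfl fun φ _ => ?_
    rw [sum_comm]
    exact sum_congr rfl fun ω _ => sum_congr rfl fun s _ => by ring

theorem Behavior.IsMixture.converts {S : CompatScenario M O} {S' : CompatScenario M' O'}
    {B : Behavior S} {B' : Behavior S'} (h : B.IsMixture B') : B.Converts B' := by
  classical
  obtain ⟨ι, _, w, m, f, hw, hw1, hm, hB⟩ := h
  let pre : Behavior (CompatScenario.mk S'.contexts : CompatScenario M' (ι × M)) :=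
    { prob := fun γ r => if γ ∈ S'.contexts then
        ∑ i, w i * if (fun x : γ => (i, m i x)) = r then 1 else 0 else 0
      nonneg := fun γ hγ r => by
        change γ ∈ S'.contexts at hγ
        rw [if_pos hγ]
        exact sum_nonneg fun i _ => mul_nonneg (hw i) (by split_ifs <;> simp)
      sum_eq_one := fun γ hγ => by
        change γ ∈ S'.contexts at hγ
        simp_rw [if_pos hγ]
        rw [sum_comm]
        simp_rw [← mul_sum, sum_ite_eq, mem_univ, if_true, mul_one, hw1]
      eq_zero_of_notMem := fun γ hγ r => if_neg hγ }
  -- The pre-processing outcome carries the component index along with the selected measurement, so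
  -- the post-processing can be deterministic and needs no shared variable.
  refine ⟨{ PreOut := ι × M, pre := pre, pre_nonContextual := ?_, toMeas := Prod.snd,
            target_mem := ?_, Shared := Unit, weight := fun _ => 1,
            weight_nonneg := fun _ => zero_le_one, weight_sum := by simp,
            post := fun _ x r s t => if f r.1 x s = t then 1 else 0,
            post_nonneg := fun _ _ _ _ _ => by split_ifs <;> simp,
            post_sum := fun _ _ _ _ => by simp }, ?_⟩
  · refine ⟨fun h => ∑ i, w i * if (fun x => (i, m i x)) = h then 1 else 0,
      fun h => sum_nonneg fun i _ => mul_nonneg (hw i) (by split_ifs <;> simp), ?_, ?_⟩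
    · rw [sum_comm]
      simp_rw [← mul_sum, sum_ite_eq, mem_univ, if_true, mul_one, hw1]
    · intro γ hγ r
      change γ ∈ S'.contexts at hγ
      simp only [pre]
      rw [if_pos hγ, sum_comm]
      refine sum_congr rfl fun i _ => ?_
      rw [← mul_sum, sum_filter]
      congr 1
      rw [sum_eq_single (fun x => (i, m i x))]
      · simp; rfl
      · intro h _ hne
        simp [hne.symm]
      · simp
  · intro β hβ r hr
    change β ∈ S'.contexts at hβ
    simp only [pre, if_pos hβ] at hr
    obtain ⟨i, -, hi⟩ := exists_lt_of_sum_lt (s := univ) (f := fun _ : ι => (0 : ℝ))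
      (by simpa using hr)
    split_ifs at hi with h
    · subst h
      exact hm i (by simpa using hi) β hβ
    · simp at hi
  · intro β hβ t
    rw [hB β hβ t, Wiring.output]
    simp only [pre, if_pos hβ, sum_mul]
    rw [sum_comm]
    refine sum_congr rfl fun i _ => ?_
    simp_rw [mul_assoc, ← mul_sum, ite_mul, one_mul, zero_mul, sum_ite_eq, mem_univ, if_true]
    rw [Behavior.relabel]
    simp_rw [prod_ite_eq_ite_funext]
    simp

end

end Contextuality

/-! ### Tilted Popescu–Rohrlich behaviors and conversions between them -/

namespace Contextuality

section

variable {n : ℕ}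

theorem edge_mem_contexts (j : ZMod n) : ({j, j + 1} : Finset (ZMod n)) ∈ (nCycle n).contexts :=
  ⟨j, rfl⟩

theorem zero_one_mem_contexts : ({0, 1} : Finset (ZMod n)) ∈ (nCycle n).contexts :=
  ⟨0, by simp⟩

theorem zmod_one_ne_zero (hn : 3 ≤ n) : (1 : ZMod n) ≠ 0 := by
  intro h
  have : ((1 : ℕ) : ZMod n) = 0 := by simpa using h
  rw [ZMod.natCast_eq_zero_iff] at this
  exact absurd (Nat.le_of_dvd one_pos this) (by omega)

theorem edge_ne_zero_one (hn : 3 ≤ n) {j : ZMod n} (hj : j ≠ 0) :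
    ({j, j + 1} : Finset (ZMod n)) ≠ {0, 1} := by
  intro h
  have h0 : (0 : ZMod n) ∈ ({j, j + 1} : Finset (ZMod n)) := h ▸ by simp
  have h1 : j ∈ ({0, 1} : Finset (ZMod n)) := h ▸ by simp
  simp only [mem_insert, mem_singleton] at h0 h1
  have hj1 : j = 1 := h1.resolve_left hj
  have h2 : ((2 : ℕ) : ZMod n) = 0 := by
    rw [h0.resolve_left (Ne.symm hj), hj1]
    norm_num
  rw [ZMod.natCast_eq_zero_iff] at h2
  exact absurd (Nat.le_of_dvd two_pos h2) (by omega)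

/-- An assignment that is anticorrelated on the context `{0, 1}` and constant on the others. -/
def twist (γ : Finset (ZMod n)) (z : ZMod n) : Bool := decide (γ = {0, 1} ∧ z = 0)

theorem twist_of_ne {γ : Finset (ZMod n)} (h : γ ≠ {0, 1}) (z : ZMod n) : twist γ z = false := by
  simp [twist, h]

/-- This is why the box is non-disturbing: its only anticorrelated context shares at most one
measurement with any other when `0 ≠ 1`, so no intersection detects the anticorrelation. -/
theorem twist_eq_on_inter {γ γ' : Finset (ZMod n)} (hγ' : γ' ∈ (nCycle n).contexts) (h : γ ≠ γ')
    {δ : Finset (ZMod n)} (hδ : δ ⊆ γ) (hδ' : δ ⊆ γ') :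
    (∀ z ∈ δ, twist γ z = false) ∨ (∀ z ∈ δ, twist γ z = true) := by
  by_cases h0 : γ = {0, 1}
  · subst h0
    by_cases hz : (0 : ZMod n) ∈ δ
    · refine Or.inr fun z hzδ => ?_
      have hz' := hδ hzδ
      simp only [mem_insert, mem_singleton] at hz'
      rcases hz' with rfl | rfl
      · simp [twist]
      · obtain ⟨j, rfl⟩ := hγ'
        refine absurd (eq_of_subset_of_card_le (s := {0, 1}) ?_ ?_) h
        · simp only [insert_subset_iff, singleton_subset_iff]
          exact ⟨hδ' hz, hδ' hzδ⟩
        · by_cases h01 : (0 : ZMod n) = 1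
          · have := subsingleton_of_zero_eq_one h01
            exact card_le_one_of_subsingleton _ |>.trans (by simp [h01])
          · rw [card_pair h01]
            exact card_le_two
    · refine Or.inl fun z hzδ => ?_
      have : z ≠ 0 := fun h => hz (h ▸ hzδ)
      simp [twist, this]
  · exact Or.inl fun z _ => twist_of_ne h0 z

/-- The mixture of the two constant assignments, with weights `x` and `y`, and of the
Popescu–Rohrlich box that is anticorrelated on `{0, 1}` and perfectly correlated on the other
contexts, with weight `t`. -/
noncomputable def tiltedProb (x y t : ℝ) (γ : Finset (ZMod n)) (s : γ → Bool) : ℝ :=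
  (if (fun _ => false) = s then x else 0) + (if (fun _ => true) = s then y else 0) +
    ((if (fun z : γ => twist γ z) = s then t / 2 else 0) +
      if (fun z : γ => !twist γ z) = s then t / 2 else 0)

theorem sum_tiltedProb_mul (x y t : ℝ) (γ : Finset (ZMod n)) (F : (γ → Bool) → ℝ) :
    ∑ s, tiltedProb x y t γ s * F s = x * F (fun _ => false) + y * F (fun _ => true) +
      (t / 2 * F (fun z => twist γ z) + t / 2 * F fun z => !twist γ z) := by
  simp [tiltedProb, add_mul, sum_add_distrib, ite_mul]

/-- The behavior of the `n`-cycle given by `tiltedProb`. -/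
noncomputable def tiltedBehavior (n : ℕ) {x y t : ℝ} (hx : 0 ≤ x) (hy : 0 ≤ y) (ht : 0 ≤ t)
    (h1 : x + y + t = 1) : Behavior (nCycle n) := by
  classical
  exact {
    prob := fun γ s => if γ ∈ (nCycle n).contexts then tiltedProb x y t γ s else 0
    nonneg := fun γ hγ s => by
      rw [if_pos hγ, tiltedProb]
      positivity
    sum_eq_one := fun γ hγ => by
      simp_rw [if_pos hγ]
      have := sum_tiltedProb_mul x y t γ fun _ => 1
      simp only [mul_one] at this
      rw [this]
      linarith
    eq_zero_of_notMem := fun γ hγ s => if_neg hγ }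

variable {x y t : ℝ} {hx : 0 ≤ x} {hy : 0 ≤ y} {ht : 0 ≤ t} {h1 : x + y + t = 1}

theorem tiltedBehavior_prob {γ : Finset (ZMod n)} (hγ : γ ∈ (nCycle n).contexts)
    (s : γ → Bool) : (tiltedBehavior n hx hy ht h1).prob γ s = tiltedProb x y t γ s :=
  if_pos hγ

theorem tiltedBehavior_isNonDisturbing : (tiltedBehavior n hx hy ht h1).IsNonDisturbing := by
  -- The right-hand side does not mention `γ`: the twisted assignment and its negation have equal
  -- weight and restrict to the two constants, in some order.
  have key : ∀ γ ∈ (nCycle n).contexts, ∀ γ' ∈ (nCycle n).contexts, γ ≠ γ' →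
      ∀ δ (hδ : δ ⊆ γ), δ ⊆ γ' → ∀ u : δ → Bool,
        marginal hδ ((tiltedBehavior n hx hy ht h1).prob γ) u =
          x * (if (fun _ => false) = u then 1 else 0) +
            y * (if (fun _ => true) = u then 1 else 0) +
          t / 2 * ((if (fun _ => false) = u then 1 else 0) +
            if (fun _ => true) = u then 1 else 0) := by
    intro γ hγ γ' hγ' hne δ hδ hδ' u
    have hsum := sum_tiltedProb_mul x y t γ fun s =>
      if Finset.restrict₂ (π := fun _ => Bool) hδ s = u then 1 else 0
    unfold marginal
    simp_rw [tiltedBehavior_prob hγ, sum_filter]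
    refine (sum_congr rfl fun s _ => by rw [mul_ite, mul_one, mul_zero]).trans (hsum.trans ?_)
    have hf : Finset.restrict₂ (π := fun _ => Bool) hδ (fun _ => false) = fun _ => false := rfl
    have ht : Finset.restrict₂ (π := fun _ => Bool) hδ (fun _ => true) = fun _ => true := rfl
    have hk : Finset.restrict₂ (π := fun _ => Bool) hδ (fun z => twist γ z) =
        fun z : δ => twist γ z := rfl
    have hk' : Finset.restrict₂ (π := fun _ => Bool) hδ (fun z => !twist γ z) =
        fun z : δ => !twist γ z := rfl
    rcases twist_eq_on_inter hγ' hne hδ hδ' with h | h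
    · have e : (fun z : δ => twist γ z) = fun _ => false := funext fun z => h z z.2
      have e' : (fun z : δ => !twist γ z) = fun _ => true := funext fun z => by simp [h z z.2]
      rw [hf, ht, hk, hk', e, e']
      split_ifs <;> ring
    · have e : (fun z : δ => twist γ z) = fun _ => true := funext fun z => h z z.2
      have e' : (fun z : δ => !twist γ z) = fun _ => false := funext fun z => by simp [h z z.2]
      rw [hf, ht, hk, hk', e, e']
      split_ifs <;> ring
  intro γ hγ γ' hγ' u
  by_cases hne : γ = γ'
  · subst hne
    rfl
  · rw [key γ hγ γ' hγ' hne _ _ inter_subset_right u,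
      key γ' hγ' γ hγ (Ne.symm hne) _ _ inter_subset_left u]

theorem target_pair {M M' : Type} [DecidableEq M] [DecidableEq M'] (m : M' → M) (a b : M') :
    target (fun z : ({a, b} : Finset M') => m z) = {m a, m b} := by
  ext z
  simp [target, eq_comm]

theorem fun_pair_eq_iff {M O : Type} [DecidableEq M] (a b : M) (g c : M → O) :
    ((fun z : ({a, b} : Finset M) => g z) = fun z : ({a, b} : Finset M) => c z) ↔
      g a = c a ∧ g b = c b := by
  simp [funext_iff]

theorem ite_fun_pair {M O : Type} [DecidableEq M] [DecidableEq O] (a b : M) (g c : M → O)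
    (r : ℝ) :
    (if (fun z : ({a, b} : Finset M) => g z) = fun z : ({a, b} : Finset M) => c z
      then r else 0) = if g a = c a ∧ g b = c b then r else 0 :=
  if_congr (fun_pair_eq_iff a b g c) rfl rfl

theorem relabel_tiltedBehavior [NeZero n] (m : ZMod n → ZMod n) (f : ZMod n → Bool → Bool)
    {β : Finset (ZMod n)} (hm : target (fun z : β => m z) ∈ (nCycle n).contexts) (u : β → Bool) :
    (tiltedBehavior n hx hy ht h1).relabel m f β u =
      x * (if (fun z : β => f z false) = u then 1 else 0) +
      y * (if (fun z : β => f z true) = u then 1 else 0) +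
      (t / 2 * (if (fun z : β => f z (twist (target fun z : β => m z) (m z))) = u then 1 else 0) +
      t / 2 * (if (fun z : β => f z (!twist (target fun z : β => m z) (m z))) = u
        then 1 else 0)) := by
  unfold Behavior.relabel
  simp_rw [tiltedBehavior_prob hm]
  exact sum_tiltedProb_mul ..

theorem relabel_tiltedBehavior_pair [NeZero n] (m : ZMod n → ZMod n) (f : ZMod n → Bool → Bool)
    (a b : ZMod n) (hm : ({m a, m b} : Finset (ZMod n)) ∈ (nCycle n).contexts)
    (c : ZMod n → Bool) :
    (tiltedBehavior n hx hy ht h1).relabel m f {a, b} (fun z => c z) =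
      x * (if f a false = c a ∧ f b false = c b then 1 else 0) +
      y * (if f a true = c a ∧ f b true = c b then 1 else 0) +
      (t / 2 * (if f a (twist {m a, m b} (m a)) = c a ∧ f b (twist {m a, m b} (m b)) = c b
        then 1 else 0) +
      t / 2 * (if f a (!twist {m a, m b} (m a)) = c a ∧ f b (!twist {m a, m b} (m b)) = c b
        then 1 else 0)) := by
  rw [relabel_tiltedBehavior m f (by rwa [target_pair])]
  rw [target_pair, ite_fun_pair a b (fun z => f z false) c,
    ite_fun_pair a b (fun z => f z true) c,
    ite_fun_pair a b (fun z => f z (twist {m a, m b} (m z))) c,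
    ite_fun_pair a b (fun z => f z (!twist {m a, m b} (m z))) c]

theorem twist_pair_ne (hn : 3 ≤ n) {a b : ZMod n} (h : ({a, b} : Finset (ZMod n)) = {0, 1}) :
    twist {a, b} b = !twist {a, b} a := by
  have h10 := zmod_one_ne_zero hn
  have ha : a ∈ ({0, 1} : Finset (ZMod n)) := h ▸ by simp
  have hb : b ∈ ({0, 1} : Finset (ZMod n)) := h ▸ by simp
  have hab : a ≠ b := by
    rintro rfl
    have h0 : (0 : ZMod n) ∈ ({a, a} : Finset (ZMod n)) := h ▸ by simp
    have h1 : (1 : ZMod n) ∈ ({a, a} : Finset (ZMod n)) := h ▸ by simp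
    simp only [mem_insert, mem_singleton, or_self] at h0 h1
    exact h10 (h1.trans h0.symm)
  simp only [mem_insert, mem_singleton] at ha hb
  rw [twist, twist, h]
  rcases ha with rfl | rfl <;> rcases hb with rfl | rfl <;> simp_all

/-- Deleting the edge `{0, 1}` leaves a path from `1` round to `0` that visits every vertex. -/
theorem eq_of_forall_eq_add_one [NeZero n] {α : Type*} {f : ZMod n → α}
    (h : ∀ j, j ≠ 0 → f j = f (j + 1)) (z : ZMod n) : f z = f 1 := by
  have key : ∀ k : ℕ, k < n → f (1 + (k : ZMod n)) = f 1 := by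
    intro k
    induction k with
    | zero => simp
    | succ k ih =>
      intro hk
      rw [← ih (by omega), h (1 + (k : ZMod n))]
      · congr 1
        push_cast
        ring
      · intro h0
        have : ((k + 1 : ℕ) : ZMod n) = 0 := by
          push_cast
          rw [add_comm]
          exact h0
        rw [ZMod.natCast_eq_zero_iff] at this
        exact absurd (Nat.le_of_dvd (Nat.succ_pos k) this) (by omega)
  have := key (z - 1).val (ZMod.val_lt _)
  rwa [ZMod.natCast_zmod_val, add_sub_cancel] at this

/-- A relabeling of a tilted behavior that is perfectly correlated on all contexts but `{0, 1}`
either is not anticorrelated at all on `{0, 1}`, or it permutes the outcomes globally. -/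
theorem relabel_tiltedBehavior_dichotomy [NeZero n] (hn : 3 ≤ n) (hx' : 0 < x) (hy' : 0 < y)
    (hyx : y ≤ x) {m : ZMod n → ZMod n} {f : ZMod n → Bool → Bool}
    (hm : ∀ j, ({m j, m (j + 1)} : Finset (ZMod n)) ∈ (nCycle n).contexts)
    (hcorr : ∀ j, j ≠ 0 → ∀ c : ZMod n → Bool, c j ≠ c (j + 1) →
      (tiltedBehavior n hx hy ht h1).relabel m f {j, j + 1} (fun z => c z) = 0) :
    ∃ p, (p = 0 ∨ p = 1) ∧
      (tiltedBehavior n hx hy ht h1).relabel m f {0, 1} (fun z => decide (z.1 = 0)) +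
        (tiltedBehavior n hx hy ht h1).relabel m f {0, 1} (fun z => !decide (z.1 = 0)) = p * t ∧
      p * y ≤ (tiltedBehavior n hx hy ht h1).relabel m f {0, 1} (fun _ => true) := by
  have h10 := zmod_one_ne_zero hn
  -- If the maps at `j` and `j + 1` differed at `b`, the constant assignment `b`, of positive
  -- weight, would produce a forbidden anticorrelated outcome.
  have hf : ∀ j, j ≠ 0 → f j = f (j + 1) := by
    intro j hj
    funext b
    by_contra hne
    have h0 := hcorr j hj (fun z => f z b) hne
    rw [relabel_tiltedBehavior_pair m f j (j + 1) (hm j) fun z => f z b] at h0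
    cases b
    · refine absurd h0 (ne_of_gt ?_)
      simp only [and_self, if_true]
      positivity
    · refine absurd h0 (ne_of_gt ?_)
      simp only [and_self, if_true]
      positivity
  have hf1 : f 0 = f 1 := eq_of_forall_eq_add_one hf 0
  have hm0 : ({m 0, m 1} : Finset (ZMod n)) ∈ (nCycle n).contexts := by simpa using hm 0
  rw [relabel_tiltedBehavior_pair m f 0 1 hm0 (fun z => decide (z = 0)),
    relabel_tiltedBehavior_pair m f 0 1 hm0 (fun z => !decide (z = 0)),
    relabel_tiltedBehavior_pair m f 0 1 hm0 (fun _ => true), hf1]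
  generalize f 1 = F
  simp only [decide_true, h10, decide_false, Bool.not_true, Bool.not_false]
  -- If the selected context is not `{0, 1}`, the source is perfectly correlated there. Otherwise a
  -- constant map destroys the anticorrelation, and a permutation keeps it while giving (true, true)
  -- weight `x` or `y`, both at least `y`.
  by_cases hγ : ({m 0, m 1} : Finset (ZMod n)) = {0, 1}
  · rw [twist_pair_ne hn hγ]
    generalize twist {m 0, m 1} (m 0) = k
    by_cases hF : F false = F true
    · refine ⟨0, Or.inl rfl, ?_, ?_⟩
      · cases hF' : F true <;> cases k <;> simp [hF, hF']
      · rw [zero_mul]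
        positivity
    · refine ⟨1, Or.inr rfl, ?_, ?_⟩
      · cases hF' : F true <;> cases hF'' : F false <;> cases k <;> simp_all
      · cases hF' : F true <;> cases hF'' : F false <;> cases k <;> simp_all
  · refine ⟨0, Or.inl rfl, ?_, ?_⟩
    · simp only [twist_of_ne hγ]
      cases hF' : F true <;> cases hF'' : F false <;> simp
    · rw [zero_mul]
      positivity

theorem tiltedProb_edge_eq_zero (hn : 3 ≤ n) {j : ZMod n} (hj : j ≠ 0) {c : ZMod n → Bool}
    (hc : c j ≠ c (j + 1)) :
    tiltedProb x y t {j, j + 1} (fun z : ({j, j + 1} : Finset (ZMod n)) => c z) = 0 := by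
  have h : ∀ b : Bool, (fun _ : ({j, j + 1} : Finset (ZMod n)) => b) ≠
      fun z : ({j, j + 1} : Finset (ZMod n)) => c z := by
    intro b hb
    obtain ⟨h, h'⟩ := (fun_pair_eq_iff j (j + 1) (fun _ => b) c).1 hb
    exact hc (h.symm.trans h')
  simp [tiltedProb, twist_of_ne (edge_ne_zero_one hn hj), h]

theorem tiltedProb_zero_one (hn : 3 ≤ n) (c : ZMod n → Bool) :
    tiltedProb x y t {0, 1} (fun z : ({0, 1} : Finset (ZMod n)) => c z) =
      (if false = c 0 ∧ false = c 1 then x else 0) + (if true = c 0 ∧ true = c 1 then y else 0) +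
      ((if true = c 0 ∧ false = c 1 then t / 2 else 0) +
        if false = c 0 ∧ true = c 1 then t / 2 else 0) := by
  have h10 := zmod_one_ne_zero hn
  rw [tiltedProb, ite_fun_pair 0 1 (fun _ => false) c, ite_fun_pair 0 1 (fun _ => true) c,
    ite_fun_pair 0 1 (fun z => twist {0, 1} z) c, ite_fun_pair 0 1 (fun z => !twist {0, 1} z) c]
  simp [twist, h10]

/-- Here `q` is the total weight of the components with `p = 1` in the dichotomy. -/
theorem tiltedBehavior_converts_necessary [NeZero n] (hn : 3 ≤ n) (hx' : 0 < x) (hy' : 0 < y)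
    (hyx : y ≤ x) {x' y' t' : ℝ} {hx₂ : 0 ≤ x'} {hy₂ : 0 ≤ y'} {ht₂ : 0 ≤ t'}
    {h₂ : x' + y' + t' = 1}
    (h : (tiltedBehavior n hx hy ht h1).Converts (tiltedBehavior n hx₂ hy₂ ht₂ h₂)) :
    ∃ q, 0 ≤ q ∧ q ≤ 1 ∧ t' = q * t ∧ q * y ≤ y' := by
  obtain ⟨ι, _, w, m, f, hw, hw1, hm, hB⟩ := h.isMixture
  have hm' : ∀ i, 0 < w i → ∀ j, ({m i j, m i (j + 1)} : Finset (ZMod n)) ∈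
      (nCycle n).contexts := fun i hi j => by
    rw [← target_pair]
    exact hm i hi _ (edge_mem_contexts j)
  have hnn : ∀ i, 0 < w i → ∀ β ∈ (nCycle n).contexts, ∀ u,
      0 ≤ (tiltedBehavior n hx hy ht h1).relabel (m i) (f i) β u := by
    intro i hi β hβ u
    rw [relabel_tiltedBehavior _ _ (hm i hi β hβ)]
    positivity
  have hcorr : ∀ i, 0 < w i → ∀ j, j ≠ 0 → ∀ c : ZMod n → Bool, c j ≠ c (j + 1) →
      (tiltedBehavior n hx hy ht h1).relabel (m i) (f i) {j, j + 1} (fun z => c z) = 0 := by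
    intro i hi j hj c hc
    have h0 := hB _ (edge_mem_contexts j) (fun z => c z)
    -- A vanishing sum of nonnegative terms vanishes termwise, so each component inherits the
    -- perfect correlations.
    rw [tiltedBehavior_prob (edge_mem_contexts j), tiltedProb_edge_eq_zero hn hj hc, eq_comm,
      sum_eq_zero_iff_of_nonneg] at h0
    · exact (mul_eq_zero.1 (h0 i (mem_univ i))).resolve_left hi.ne'
    · intro k _
      rcases (hw k).eq_or_lt with hk | hk
      · simp [← hk]
      · exact mul_nonneg hk.le (hnn k hk _ (edge_mem_contexts j) _)
  have hD : ∀ i, ∃ p : ℝ, (p = 0 ∨ p = 1) ∧ (0 < w i →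
      (tiltedBehavior n hx hy ht h1).relabel (m i) (f i) {0, 1} (fun z => decide (z.1 = 0)) +
        (tiltedBehavior n hx hy ht h1).relabel (m i) (f i) {0, 1} (fun z => !decide (z.1 = 0)) =
          p * t ∧
      p * y ≤ (tiltedBehavior n hx hy ht h1).relabel (m i) (f i) {0, 1} (fun _ => true)) := by
    intro i
    rcases (hw i).eq_or_lt with hi | hi
    · exact ⟨0, Or.inl rfl, fun h => absurd hi h.ne⟩
    · obtain ⟨p, hp, h⟩ := relabel_tiltedBehavior_dichotomy hn hx' hy' hyx (hm' i hi) (hcorr i hi)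
      exact ⟨p, hp, fun _ => h⟩
  choose p hp hD using hD
  have h10 := zmod_one_ne_zero hn
  refine ⟨∑ i, w i * p i, sum_nonneg fun i _ => mul_nonneg (hw i) ?_, ?_, ?_, ?_⟩
  · rcases hp i with h | h <;> simp [h]
  · rw [← hw1]
    refine sum_le_sum fun i _ => mul_le_of_le_one_right (hw i) ?_
    rcases hp i with h | h <;> simp [h]
  · have e1 := hB _ zero_one_mem_contexts fun z => decide (z.1 = 0)
    have e2 := hB _ zero_one_mem_contexts fun z => !decide (z.1 = 0)
    rw [tiltedBehavior_prob zero_one_mem_contexts,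
      tiltedProb_zero_one hn fun z => decide (z = 0)] at e1
    rw [tiltedBehavior_prob zero_one_mem_contexts,
      tiltedProb_zero_one hn fun z => !decide (z = 0)] at e2
    simp [h10] at e1 e2
    rw [← add_halves t']
    nth_rewrite 1 [e1]
    rw [e2, ← sum_add_distrib, sum_mul]
    refine sum_congr rfl fun i _ => ?_
    rcases (hw i).eq_or_lt with hi | hi
    · simp [← hi]
    · rw [← mul_add, (hD i hi).1, mul_assoc]
  · have e := hB _ zero_one_mem_contexts fun _ => true
    rw [tiltedBehavior_prob zero_one_mem_contexts,
      tiltedProb_zero_one hn fun _ => true] at e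
    simp at e
    rw [e, sum_mul]
    refine sum_le_sum fun i _ => ?_
    rcases (hw i).eq_or_lt with hi | hi
    · simp [← hi]
    · rw [mul_assoc]
      exact mul_le_mul_of_nonneg_left (hD i hi).2 hi.le

/-- With probability `q` the behavior is kept; otherwise every outcome is replaced by `false`. This
multiplies `y` and `t` by `q`, and the constant `false` absorbs the rest. -/
theorem tiltedBehavior_converts_of_le [NeZero n] {x' y' t' q : ℝ} {hx₂ : 0 ≤ x'} {hy₂ : 0 ≤ y'}
    {ht₂ : 0 ≤ t'} {h₂ : x' + y' + t' = 1} (hq0 : 0 ≤ q) (hq1 : q ≤ 1) (ht' : t' = q * t)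
    (hy' : y' = q * y) :
    (tiltedBehavior n hx hy ht h1).Converts (tiltedBehavior n hx₂ hy₂ ht₂ h₂) := by
  refine Behavior.IsMixture.converts ⟨Bool, inferInstance, fun b => cond b q (1 - q),
    fun _ z => z, fun b _ o => b && o, ?_, by simp, ?_, ?_⟩
  · intro b
    cases b
    · exact sub_nonneg.2 hq1
    · exact hq0
  · intro _ _ β hβ
    rwa [target_val]
  · intro β hβ u
    have hβ' : target (fun z : β => (z : ZMod n)) ∈ (nCycle n).contexts := by rwa [target_val]
    rw [tiltedBehavior_prob hβ, Fintype.sum_bool, relabel_tiltedBehavior _ _ hβ',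
      relabel_tiltedBehavior _ _ hβ', tiltedProb]
    simp only [target_val, Bool.true_and, Bool.false_and, cond_true, cond_false, ht', hy']
    have hx' : x' = q * x + (1 - q) := by
      subst ht' hy'
      linear_combination h₂ - q * h1
    rw [hx']
    have e : (if (fun _ => false) = u then q * x + (1 - q) else 0) =
        q * (x * (if (fun _ => false) = u then 1 else 0)) +
          (1 - q) * (if (fun _ => false) = u then 1 else 0) := by
      split_ifs <;> ring
    have e' : ∀ (P : Prop) [Decidable P] (a b : ℝ),
        (if P then a * b else 0) = a * (b * if P then 1 else 0) := by
      intro P _ a b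
      split_ifs <;> simp
    rw [e]
    simp_rw [mul_div_assoc, e']
    linear_combination (q - 1) * (if (fun _ => false) = u then 1 else 0) * h1

end

end Contextuality

/-! ### Chains and antichains in the parameter plane -/

namespace Contextuality

section

variable {n : ℕ}

/-- Parameters of a tilted behavior: the weight of the Popescu–Rohrlich box, and the weight of the
constant assignment `true` relative to it. -/
def TiltParam : Type := {p : ℝ × ℝ // 0 < p.1 ∧ 0 < p.2 ∧ p.1 * (1 + 2 * p.2) ≤ 1}

namespace TiltParam

/-- The third condition on the parameters is precisely the requirement `y ≤ x`. -/
theorem weight_false_ge (p : TiltParam) : p.1.1 * p.1.2 ≤ 1 - p.1.1 - p.1.1 * p.1.2 := by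
  linarith [p.2.2.2]

theorem weight_true_pos (p : TiltParam) : 0 < p.1.1 * p.1.2 := mul_pos p.2.1 p.2.2.1

theorem weight_false_nonneg (p : TiltParam) : 0 ≤ 1 - p.1.1 - p.1.1 * p.1.2 :=
  p.weight_true_pos.le.trans p.weight_false_ge

theorem sum_weights (p : TiltParam) :
    1 - p.1.1 - p.1.1 * p.1.2 + p.1.1 * p.1.2 + p.1.1 = 1 := by
  ring

end TiltParam

/-- The tilted behavior with the given parameters. -/
noncomputable def tilted (n : ℕ) (p : TiltParam) : ND (nCycle n) :=
  ⟨tiltedBehavior n p.weight_false_nonneg p.weight_true_pos.le p.2.1.le p.sum_weights,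
    tiltedBehavior_isNonDisturbing⟩

theorem tilted_conv_necessary [NeZero n] (hn : 3 ≤ n) {p q : TiltParam}
    (h : ND.conv (tilted n p) (tilted n q)) : q.1.1 ≤ p.1.1 ∧ p.1.2 ≤ q.1.2 := by
  obtain ⟨c, hc0, hc1, hct, hcy⟩ := tiltedBehavior_converts_necessary (hx := p.weight_false_nonneg)
    (hy := p.weight_true_pos.le) (ht := p.2.1.le) (h1 := p.sum_weights)
    (hx₂ := q.weight_false_nonneg) (hy₂ := q.weight_true_pos.le) (ht₂ := q.2.1.le)
    (h₂ := q.sum_weights) hn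
    (p.weight_true_pos.trans_le p.weight_false_ge) p.weight_true_pos p.weight_false_ge h
  refine ⟨hct ▸ mul_le_of_le_one_left p.2.1.le hc1, ?_⟩
  rw [← mul_assoc, ← hct] at hcy
  -- Substituting `c * p.1.1 = q.1.1` leaves a common positive factor `q.1.1`, the weight of the box
  -- in the result.
  exact le_of_mul_le_mul_left hcy q.2.1

theorem tilted_conv_of_le [NeZero n] {p q : TiltParam} (h₁ : q.1.1 ≤ p.1.1)
    (h₂ : p.1.2 = q.1.2) : ND.conv (tilted n p) (tilted n q) := by
  have hp := p.2.1
  have h : q.1.1 = q.1.1 / p.1.1 * p.1.1 := by field_simp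
  refine tiltedBehavior_converts_of_le (hx := p.weight_false_nonneg)
    (hy := p.weight_true_pos.le) (ht := p.2.1.le) (h1 := p.sum_weights)
    (hx₂ := q.weight_false_nonneg) (hy₂ := q.weight_true_pos.le) (ht₂ := q.2.1.le)
    (h₂ := q.sum_weights)
    (q := q.1.1 / p.1.1) (div_nonneg q.2.1.le hp.le)
    (div_le_one_of_le₀ h₁ hp.le) h ?_
  rw [← mul_assoc, ← h, h₂]

theorem tilted_incomparable [NeZero n] (hn : 3 ≤ n) {p q : TiltParam} (h₁ : p.1.1 < q.1.1)
    (h₂ : p.1.2 < q.1.2) : Incomparable ND.conv (tilted n p) (tilted n q) :=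
  ⟨fun h => (tilted_conv_necessary hn h).1.not_gt h₁,
    fun h => (tilted_conv_necessary hn h).2.not_gt h₂⟩

theorem tilted_strictlyAbove [NeZero n] (hn : 3 ≤ n) {p q : TiltParam} (h₁ : q.1.1 < p.1.1)
    (h₂ : p.1.2 = q.1.2) : StrictlyAbove ND.conv (tilted n p) (tilted n q) :=
  ⟨tilted_conv_of_le h₁.le h₂, fun h => (tilted_conv_necessary hn h).1.not_gt h₁⟩

theorem Incomparable.symm {α : Type*} {r : α → α → Prop} {a b : α} (h : Incomparable r a b) :
    Incomparable r b a :=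
  ⟨h.2, h.1⟩

/-- The parameters `(s, 1)`. -/
def chainParam (s : Set.Icc (1 / 8 : ℝ) (1 / 4)) : TiltParam :=
  ⟨(s, 1), by linarith [s.2.1], one_pos, by linarith [s.2.2]⟩

/-- The parameters `(s, s)`. -/
def antichainParam (s : Set.Icc (1 / 8 : ℝ) (1 / 4)) : TiltParam :=
  ⟨(s, s), by linarith [s.2.1], by linarith [s.2.1], by nlinarith [s.2.1, s.2.2]⟩

theorem chain_strictlyAbove [NeZero n] (hn : 3 ≤ n) {a b : Set.Icc (1 / 8 : ℝ) (1 / 4)}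
    (h : b < a) : StrictlyAbove ND.conv (tilted n (chainParam a)) (tilted n (chainParam b)) :=
  tilted_strictlyAbove hn h rfl

theorem antichain_incomparable [NeZero n] (hn : 3 ≤ n) {a b : Set.Icc (1 / 8 : ℝ) (1 / 4)}
    (h : a ≠ b) :
    Incomparable ND.conv (tilted n (antichainParam a)) (tilted n (antichainParam b)) := by
  rcases h.lt_or_gt with h | h
  · exact tilted_incomparable hn h h
  · exact (tilted_incomparable hn h h).symm

theorem infinite_Icc_eighth_quarter : Infinite (Set.Icc (1 / 8 : ℝ) (1 / 4)) :=
  (Set.Icc_infinite (by norm_num)).to_subtype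

theorem nd_conv_refl {M O : Type} [DecidableEq M] [Fintype M] [DecidableEq O] [Fintype O]
    {S : CompatScenario M O} (B : ND S) : ND.conv B B :=
  B.1.isMixture_refl.converts

theorem nd_conv_trans {M O : Type} [DecidableEq M] [Fintype M] [DecidableEq O] [Fintype O]
    {S : CompatScenario M O} {B₁ B₂ B₃ : ND S} (h : ND.conv B₁ B₂) (h' : ND.conv B₂ B₃) :
    ND.conv B₁ B₃ :=
  (Behavior.Converts.isMixture h |>.trans (Behavior.Converts.isMixture h')).converts

/-- The chain at ratio `1` is a continuum of inequivalent behaviors between its two endpoints. -/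
theorem nCycle_locallyInfinite [NeZero n] (hn : 3 ≤ n) :
    LocallyInfinite (ND.conv (S := nCycle n)) := by
  intro h
  have := infinite_Icc_eighth_quarter
  let lo : Set.Icc (1 / 8 : ℝ) (1 / 4) := ⟨1 / 8, by norm_num, by norm_num⟩
  let hi : Set.Icc (1 / 8 : ℝ) (1 / 4) := ⟨1 / 4, by norm_num, by norm_num⟩
  have hlt : lo < hi := Subtype.mk_lt_mk.2 (by norm_num)
  have hfin := h (tilted n (chainParam hi)) (tilted n (chainParam lo))
    fun he => (chain_strictlyAbove hn hlt).2 he.2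
  refine Set.infinite_of_injective_forall_mem (f := fun s =>
    equivClass (ND.conv (S := nCycle n)) (tilted n (chainParam s))) ?_ (fun s => ?_) hfin
  · intro a b hab
    have hb : tilted n (chainParam b) ∈
        equivClass (ND.conv (S := nCycle n)) (tilted n (chainParam a)) := by
      simp only at hab
      rw [hab]
      exact ⟨nd_conv_refl _, nd_conv_refl _⟩
    by_contra hne
    rcases Ne.lt_or_gt hne with h | h
    · exact (chain_strictlyAbove hn h).2 hb.1
    · exact (chain_strictlyAbove hn h).2 hb.2
  · exact ⟨tilted n (chainParam s), ⟨tilted_conv_of_le (p := chainParam hi) s.2.2 rfl,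
      tilted_conv_of_le (q := chainParam lo) s.2.1 rfl⟩, rfl⟩

theorem nCycle_not_totallyPreordered [NeZero n] (hn : 3 ≤ n) :
    ¬ TotallyPreordered (ND.conv (S := nCycle n)) := by
  intro h
  have := infinite_Icc_eighth_quarter
  obtain ⟨a, b, hab⟩ := exists_pair_ne (Set.Icc (1 / 8 : ℝ) (1 / 4))
  have hi := antichain_incomparable hn hab
  rcases h (tilted n (antichainParam a)) (tilted n (antichainParam b)) with h | h | h
  · exact hi.1 h.1
  · exact hi.2 h.1
  · exact hi.1 h.1

theorem nCycle_not_isWeakPreorder [NeZero n] (hn : 3 ≤ n) :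
    ¬ IsWeakPreorder (ND.conv (S := nCycle n)) := by
  intro h
  -- Both coordinates of `b` lie below those of `a` and `c`, while `a` and `c` share their ratio and
  -- differ in the weight of the box.
  let a : TiltParam := ⟨(1 / 4, 1), by norm_num⟩
  let b : TiltParam := ⟨(1 / 16, 1 / 2), by norm_num⟩
  let c : TiltParam := ⟨(1 / 8, 1), by norm_num⟩
  have hba : Incomparable ND.conv (tilted n b) (tilted n a) :=
    tilted_incomparable hn (by norm_num [a, b]) (by norm_num [a, b])
  have hbc : Incomparable ND.conv (tilted n b) (tilted n c) :=
    tilted_incomparable hn (by norm_num [b, c]) (by norm_num [b, c])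
  have hac : StrictlyAbove ND.conv (tilted n a) (tilted n c) :=
    tilted_strictlyAbove hn (by norm_num [a, c]) rfl
  rcases h _ _ _ hba.symm hbc with h | h
  · exact h.1 hac.1
  · exact hac.2 h.2

theorem nCycle_infiniteHeight [NeZero n] (hn : 3 ≤ n) :
    InfiniteHeight (ND.conv (S := nCycle n)) := by
  have := infinite_Icc_eighth_quarter
  refine ⟨Set.range fun s => tilted n (chainParam s), ?_, Set.infinite_range_of_injective ?_⟩
  · rintro _ ⟨a, rfl⟩ _ ⟨b, rfl⟩ hne
    have hab : a ≠ b := fun h => hne (h ▸ rfl)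
    rcases hab.lt_or_gt with h | h
    · exact Or.inr (chain_strictlyAbove hn h)
    · exact Or.inl (chain_strictlyAbove hn h)
  · intro a b hab
    simp only at hab
    by_contra hne
    rcases Ne.lt_or_gt hne with h | h
    · exact (chain_strictlyAbove hn h).2 (hab ▸ nd_conv_refl _)
    · exact (chain_strictlyAbove hn h).2 (hab ▸ nd_conv_refl _)

theorem nCycle_infiniteWidth [NeZero n] (hn : 3 ≤ n) :
    InfiniteWidth (ND.conv (S := nCycle n)) := by
  have := infinite_Icc_eighth_quarter
  refine ⟨Set.range fun s => tilted n (antichainParam s), ?_, Set.infinite_range_of_injective ?_⟩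
  · rintro _ ⟨a, rfl⟩ _ ⟨b, rfl⟩ hne
    exact antichain_incomparable hn fun h => hne (h ▸ rfl)
  · intro a b hab
    simp only at hab
    by_contra hne
    exact (antichain_incomparable hn hne).1 (hab ▸ nd_conv_refl _)

end

end Contextuality

theorem theorem6 (n : ℕ) [NeZero n] (hn : 3 ≤ n) :
    (∀ B : Contextuality.ND (Contextuality.nCycle n), Contextuality.ND.conv B B) ∧
    (∀ B₁ B₂ B₃ : Contextuality.ND (Contextuality.nCycle n),
      Contextuality.ND.conv B₁ B₂ → Contextuality.ND.conv B₂ B₃ →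
        Contextuality.ND.conv B₁ B₃) ∧
    Contextuality.LocallyInfinite
      (Contextuality.ND.conv (S := Contextuality.nCycle n)) ∧
    ¬ Contextuality.TotallyPreordered
      (Contextuality.ND.conv (S := Contextuality.nCycle n)) ∧
    ¬ Contextuality.IsWeakPreorder
      (Contextuality.ND.conv (S := Contextuality.nCycle n)) ∧
    Contextuality.InfiniteHeight
      (Contextuality.ND.conv (S := Contextuality.nCycle n)) ∧
    Contextuality.InfiniteWidth
      (Contextuality.ND.conv (S := Contextuality.nCycle n)) :=
  ⟨Contextuality.nd_conv_refl, fun _ _ _ => Contextuality.nd_conv_trans,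
    Contextuality.nCycle_locallyInfinite hn, Contextuality.nCycle_not_totallyPreordered hn,
    Contextuality.nCycle_not_isWeakPreorder hn, Contextuality.nCycle_infiniteHeight hn,
    Contextuality.nCycle_infiniteWidth hn⟩
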